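/- For a non-empty set $X$ let $\mathrm{Rel}(X)$ be the set of binary relations on $X$, and for $s,t\in\mathrm{Rel}(X)$ put $$s\mathbin{;}t=\{(x,y):\exists z\,((x,z)\in s\wedge(z,y)\in t)\},$$ $$s*t=\{(x,y)\in s\mathbin{;}t:\forall w\,((x,w)\in s\rightarrow\exists v\,(w,v)\in t)\},$$ $$s\sqcup\!\!\sqcup\, t=\{(x,y)\in s\cup t: x\in\mathrm{dom}(s)\cap\mathrm{dom}(t)\}$$ (angelic composition, demonic composition and demonic join). A relation $s\in\mathrm{Rel}(X)$ is left total if its domain is $X$, and total if both its domain and its range are $X$. Let $X_0=X\cup\{0\}$ with $0\notin X$, and let $\mathcal L_0(X)$ be the set of left total relations $\rho$ on $X_0$ such that, for all $s\in X_0$, $(0,s)\in\rho$ if and only if $s=0$. Consider structures with two binary operations (a composition and a join). Let $R(;,\cup)$, $L(;,\cup)$, $T(;,\cup)$ be the closures under isomorphism of the classes of all non-empty sets of, respectively, arbitrary, left total, and total binary relations on some non-empty set $X$ that are closed under $;$ and $\cup$, with these operations. Let $L_0(;,\cup)$ be the closure under isomorphism of the class of all non-empty subsets of $\mathcal L_0(X)$,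 for some non-empty set $X$, that are closed under $;$ and $\cup$, with these operations. Let $R(*,\sqcup\!\!\sqcup)$ be the closure under isomorphism of the class of all non-empty sets of binary relations on some non-empty set $X$ that are closed under $*$ and $\sqcup\!\!\sqcup$, with these operations. Identify the signatures by matching the composition symbols with each other and the join symbols with each other. Then $$R(;,\cup)=L(;,\cup)=L_0(;,\cup)=T(;,\cup)=R(*,\sqcup\!\!\sqcup).$$ In particular, a first-order sentence in one composition symbol and one join symbol holds in all members of $R(;,\cup)$ if and only if it holds in all members of $R(*,\sqcup\!\!\sqcup)$. Moreover, none of the five classes is finitely axiomatisable, that is, none is the class of all (non-empty) models of a finite set of first-order sentences. -/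

import Mathlib

universe u

namespace DemonicRelations

open FirstOrder CategoryTheory

/-! ### Operations on binary relations

A binary relation on `X` is a term of Mathlib's `SetRel X X = Set (X × X)`; angelic composition is
`SetRel.comp`, angelic join is union, and the domain is `SetRel.dom`. -/

/-- Demonic composition `s * t`. -/
def demonicComp {X : Type u} (s t : SetRel X X) : SetRel X X :=
  {p | (∃ z, (p.1, z) ∈ s ∧ (z, p.2) ∈ t) ∧ ∀ w, (p.1, w) ∈ s → ∃ v, (w, v) ∈ t}

/-- Demonic join: the union restricted to the common domain. -/
def demonicJoin {X : Type u} (s t : SetRel X X) : SetRel X X :=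
  {p | p ∈ s ∪ t ∧ p.1 ∈ s.dom ∩ t.dom}

/-- Left total relations: every point is related to some point. -/
def IsLeftTotal {X : Type u} (s : SetRel X X) : Prop := ∀ x, ∃ y, (x, y) ∈ s

/-- Total relations: both the domain and the range are the whole base set. -/
def IsTotal {X : Type u} (s : SetRel X X) : Prop :=
  (∀ x, ∃ y, (x, y) ∈ s) ∧ ∀ y, ∃ x, (x, y) ∈ s

/-- Left total relations on `X₀ = X ∪ {0}`, encoded as `Option X` with `0 = none`,
that relate `0` to `0` and to nothing else. -/
def IsLeftTotalZero {X : Type u} (s : SetRel (Option X) (Option X)) : Prop :=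
  IsLeftTotal s ∧ ∀ y : Option X, (none, y) ∈ s ↔ y = none

/-! ### The first-order signature: a composition symbol and a join symbol -/

/-- The function symbols: two binary ones. -/
inductive CompJoinFunc : ℕ → Type
  | comp : CompJoinFunc 2
  | join : CompJoinFunc 2

/-- The first-order language with two binary function symbols (and equality). -/
def compJoin : FirstOrder.Language.{0, 0} := ⟨CompJoinFunc, fun _ => Empty⟩

/-- `Rel(X)` with angelic composition and union. -/
def AngelicRel (X : Type u) : Type u := SetRel X X

/-- `Rel(X)` with demonic composition and demonic join. -/
def DemonicRel (X : Type u) : Type u := SetRel X X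

instance angelicStructure (X : Type u) : compJoin.Structure (AngelicRel X) where
  funMap := fun {_} f => match f with
    | .comp => fun v => SetRel.comp (v 0 : SetRel X X) (v 1 : SetRel X X)
    | .join => fun v => ((v 0 : SetRel X X) ∪ (v 1 : SetRel X X) : SetRel X X)
  RelMap := fun {_} r => Empty.elim r

instance demonicStructure (X : Type u) : compJoin.Structure (DemonicRel X) where
  funMap := fun {_} f => match f with
    | .comp => fun v => demonicComp (v 0 : SetRel X X) (v 1 : SetRel X X)
    | .join => fun v => demonicJoin (v 0 : SetRel X X) (v 1 : SetRel X X)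
  RelMap := fun {_} r => Empty.elim r

/-! ### The representation classes

Each class is the closure under isomorphism of a class of algebras of binary relations, that is, of
nonempty sets of relations on a nonempty base, closed under the two operations. -/

/-- `R(;,∪)`: algebras of binary relations under composition and union. -/
def classR : Set (Bundled.{u} compJoin.Structure) :=
  {A | ∃ (X : Type u) (_ : Nonempty X) (B : compJoin.Substructure (AngelicRel X)),
    Nonempty B ∧ Nonempty (A ≃[compJoin] B)}

/-- `L(;,∪)`: algebras of left total relations under composition and union. -/
def classL : Set (Bundled.{u} compJoin.Structure) :=
  {A | ∃ (X : Type u) (_ : Nonempty X) (B : compJoin.Substructure (AngelicRel X)),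
    Nonempty B ∧ (∀ s ∈ B, IsLeftTotal (X := X) s) ∧ Nonempty (A ≃[compJoin] B)}

/-- `L₀(;,∪)`: algebras, under composition and union, of left total relations on `X ∪ {0}` that
relate `0` exactly to `0`. -/
def classL₀ : Set (Bundled.{u} compJoin.Structure) :=
  {A | ∃ (X : Type u) (_ : Nonempty X) (B : compJoin.Substructure (AngelicRel (Option X))),
    Nonempty B ∧ (∀ s ∈ B, IsLeftTotalZero (X := X) s) ∧ Nonempty (A ≃[compJoin] B)}

/-- `T(;,∪)`: algebras of total relations under composition and union. -/
def classT : Set (Bundled.{u} compJoin.Structure) :=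
  {A | ∃ (X : Type u) (_ : Nonempty X) (B : compJoin.Substructure (AngelicRel X)),
    Nonempty B ∧ (∀ s ∈ B, IsTotal (X := X) s) ∧ Nonempty (A ≃[compJoin] B)}

/-- `R(*,⊔⊔)`: algebras of binary relations under demonic composition and demonic join. -/
def classRDemonic : Set (Bundled.{u} compJoin.Structure) :=
  {A | ∃ (X : Type u) (_ : Nonempty X) (B : compJoin.Substructure (DemonicRel X)),
    Nonempty B ∧ Nonempty (A ≃[compJoin] B)}

/-- A class is finitely axiomatisable if it is the class of all (nonempty) models of some finite set
of first-order sentences. -/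
def FinitelyAxiomatisable (K : Set (Bundled.{u} compJoin.Structure)) : Prop :=
  ∃ T : compJoin.Theory, T.Finite ∧
    ∀ A : Bundled.{u} compJoin.Structure, A ∈ K ↔ Nonempty A ∧ A ⊨ T

end DemonicRelations

/-! The five classes coincide because a single added point corrects each defect. A sink makes
relations left total (`sinkExt`), a source makes them onto (`sourceExt`), and a chaos point
absorbing undefinedness turns demonic operations into angelic ones (`chaosExt`). Conversely, on left
total relations the demonic and angelic operations agree.

Non-finite axiomatisability then needs proof for `classR` only, by exhibiting non-members with an
ultraproduct in the class. A loop-free graph with a distinguished point `a` is coded by the algebra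
`ClosedAlg`, representable exactly when the graph off `a` is 2-colourable:
`exists_embedding_of_colouring` and `exists_colouring_of_embedding`. Graphs with a single odd cycle
are not 2-colourable, but when the cycle lengths tend to infinity their ultraproduct is. The
ultraproduct of the algebras embeds into the algebra of the ultraproduct (`ultraEmbedding`), hence
is representable, and Łoś's theorem rules out a finite axiomatisation. -/

namespace DemonicRelations

open FirstOrder CategoryTheory FirstOrder.Language

/-! ### Embeddings of algebras with a composition and a join -/

section Embeddings

universe v w

variable {M : Type v} {N : Type w} [compJoin.Structure M] [compJoin.Structure N]

/-- The composition of an algebra in the signature `compJoin`. -/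
def opComp (x y : M) : M := Structure.funMap (L := compJoin) CompJoinFunc.comp ![x, y]

/-- The join of an algebra in the signature `compJoin`. -/
def opJoin (x y : M) : M := Structure.funMap (L := compJoin) CompJoinFunc.join ![x, y]

/-- An injection preserving composition and join is an embedding. -/
def embeddingOf (g : M → N) (hg : Function.Injective g)
    (hc : ∀ x y, g (opComp x y) = opComp (g x) (g y))
    (hj : ∀ x y, g (opJoin x y) = opJoin (g x) (g y)) : M ↪[compJoin] N where
  toFun := g
  inj' := hg
  map_fun' := by
    intro n f x
    have hx : ∀ x : Fin 2 → M, x = ![x 0, x 1] := fun x => by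
      funext i; fin_cases i <;> rfl
    have hgx : ∀ x : Fin 2 → M, g ∘ x = ![g (x 0), g (x 1)] := fun x => by
      funext i; fin_cases i <;> rfl
    cases f with
    | comp =>
      rw [hgx x]
      conv_lhs => rw [hx x]
      exact hc _ _
    | join =>
      rw [hgx x]
      conv_lhs => rw [hx x]
      exact hj _ _
  map_rel' := fun r => Empty.elim r

theorem map_opComp (g : M ↪[compJoin] N) (x y : M) : g (opComp x y) = opComp (g x) (g y) :=
  (g.map_fun _ _).trans (congrArg _ (funext fun i => by fin_cases i <;> rfl))

theorem map_opJoin (g : M ↪[compJoin] N) (x y : M) : g (opJoin x y) = opJoin (g x) (g y) :=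
  (g.map_fun _ _).trans (congrArg _ (funext fun i => by fin_cases i <;> rfl))

/-- Being isomorphic to a nonempty subalgebra all of whose elements satisfy `P` amounts to having
an embedding all of whose values satisfy `P`. -/
theorem exists_substructure_iff (P : N → Prop) :
    (∃ B : compJoin.Substructure N, Nonempty B ∧ (∀ s ∈ B, P s) ∧ Nonempty (M ≃[compJoin] B)) ↔
      Nonempty M ∧ ∃ g : M ↪[compJoin] N, ∀ a, P (g a) := by
  constructor
  · rintro ⟨B, ⟨b⟩, hP, ⟨e⟩⟩
    exact ⟨⟨e.symm b⟩, B.subtype.comp e.toEmbedding, fun a => hP _ (e a).2⟩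
  · rintro ⟨⟨a⟩, g, hP⟩
    refine ⟨g.toHom.range, ⟨g.equivRange a⟩, ?_, ⟨g.equivRange⟩⟩
    rintro s ⟨a, rfl⟩
    exact hP a

end Embeddings

/-! ### Equality of the five classes by one-point extensions. -/

section Classes

variable {X : Type u}

theorem mem_classR {A : Bundled.{u} compJoin.Structure} :
    A ∈ classR ↔ ∃ (X : Type u) (_ : Nonempty X),
      Nonempty A ∧ Nonempty (A ↪[compJoin] AngelicRel X) := by
  refine exists_congr fun X => exists_congr fun _ => ?_
  refine Iff.trans ?_ ((exists_substructure_iff (M := A) (N := AngelicRel X) fun _ => True).trans ?_)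
  · simp only [implies_true, true_and]
  · simp only [implies_true, exists_true_iff_nonempty]

theorem mem_classL {A : Bundled.{u} compJoin.Structure} :
    A ∈ classL ↔ ∃ (X : Type u) (_ : Nonempty X),
      Nonempty A ∧ ∃ g : A ↪[compJoin] AngelicRel X, ∀ a, IsLeftTotal (X := X) (g a) :=
  exists_congr fun X => exists_congr fun _ => exists_substructure_iff (N := AngelicRel X) _

theorem mem_classL₀ {A : Bundled.{u} compJoin.Structure} :
    A ∈ classL₀ ↔ ∃ (X : Type u) (_ : Nonempty X),
      Nonempty A ∧ ∃ g : A ↪[compJoin] AngelicRel (Option X),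
        ∀ a, IsLeftTotalZero (X := X) (g a) :=
  exists_congr fun X => exists_congr fun _ =>
    exists_substructure_iff (N := AngelicRel (Option X)) _

theorem mem_classT {A : Bundled.{u} compJoin.Structure} :
    A ∈ classT ↔ ∃ (X : Type u) (_ : Nonempty X),
      Nonempty A ∧ ∃ g : A ↪[compJoin] AngelicRel X, ∀ a, IsTotal (X := X) (g a) :=
  exists_congr fun X => exists_congr fun _ => exists_substructure_iff (N := AngelicRel X) _

theorem mem_classRDemonic {A : Bundled.{u} compJoin.Structure} :
    A ∈ classRDemonic ↔ ∃ (X : Type u) (_ : Nonempty X),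
      Nonempty A ∧ Nonempty (A ↪[compJoin] DemonicRel X) := by
  refine exists_congr fun X => exists_congr fun _ => ?_
  refine Iff.trans ?_ ((exists_substructure_iff (M := A) (N := DemonicRel X) fun _ => True).trans ?_)
  · simp only [implies_true, true_and]
  · simp only [implies_true, exists_true_iff_nonempty]

/-- Add a sink `none`: every point is related to it, and it is related to itself only. -/
def sinkExt (s : SetRel X X) : SetRel (Option X) (Option X) :=
  {p | p.2 = none ∨ ∃ x y, p = (some x, some y) ∧ (x, y) ∈ s}

@[simp] theorem mem_sinkExt_none (s : SetRel X X) (x : Option X) : (x, none) ∈ sinkExt s := by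
  simp [sinkExt]

@[simp] theorem mem_sinkExt_some (s : SetRel X X) (x y : X) :
    (some x, some y) ∈ sinkExt s ↔ (x, y) ∈ s := by
  simp [sinkExt]

@[simp] theorem not_mem_sinkExt (s : SetRel X X) (y : X) : (none, some y) ∉ sinkExt s := by
  simp [sinkExt]

/-- Add a source `none`: it is related to every point, and only itself is related to it. -/
def sourceExt (s : SetRel X X) : SetRel (Option X) (Option X) :=
  {p | p.1 = none ∨ ∃ x y, p = (some x, some y) ∧ (x, y) ∈ s}

@[simp] theorem mem_sourceExt_none (s : SetRel X X) (y : Option X) : (none, y) ∈ sourceExt s := by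
  simp [sourceExt]

@[simp] theorem mem_sourceExt_some (s : SetRel X X) (x y : X) :
    (some x, some y) ∈ sourceExt s ↔ (x, y) ∈ s := by
  simp [sourceExt]

@[simp] theorem not_mem_sourceExt (s : SetRel X X) (x : X) : (some x, none) ∉ sourceExt s := by
  simp [sourceExt]

/-- Add a point `none` of nontermination: it is related to every point, and so is every point
outside the domain. -/
def chaosExt (s : SetRel X X) : SetRel (Option X) (Option X) :=
  {p | ∀ x, p.1 = some x → x ∈ s.dom → ∃ y, p.2 = some y ∧ (x, y) ∈ s}

@[simp] theorem mem_chaosExt_none (s : SetRel X X) (y : Option X) : (none, y) ∈ chaosExt s := by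
  simp [chaosExt]

@[simp] theorem mem_chaosExt_some (s : SetRel X X) (x y : X) :
    (some x, some y) ∈ chaosExt s ↔ (x ∈ s.dom → (x, y) ∈ s) := by
  simp [chaosExt]

@[simp] theorem mem_chaosExt_some_none (s : SetRel X X) (x : X) :
    (some x, none) ∈ chaosExt s ↔ x ∉ s.dom := by
  simp [chaosExt]

theorem mem_chaosExt_of_mem_dom {s : SetRel X X} {x : X} (hx : x ∈ s.dom) (y : Option X) :
    (some x, y) ∈ chaosExt s ↔ ∃ z, y = some z ∧ (x, z) ∈ s := by
  simp only [chaosExt, Set.mem_ofPred_eq, Option.some.injEq, forall_eq', hx, true_imp_iff]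

theorem mem_chaosExt_of_not_mem_dom {s : SetRel X X} {x : X} (hx : x ∉ s.dom) (y : Option X) :
    (some x, y) ∈ chaosExt s := by
  rintro z h hz
  cases h
  exact absurd hz hx

theorem sinkExt_injective : Function.Injective (sinkExt (X := X)) := by
  rintro s t h
  ext ⟨x, y⟩
  rw [← mem_sinkExt_some s, ← mem_sinkExt_some t, h]

/-- Nothing leaves the sink, so it is never an intermediate point between old points, and it is
itself the intermediate point for pairs that end in it. The source behaves dually. -/
theorem sinkExt_comp (s t : SetRel X X) :
    sinkExt (s.comp t) = SetRel.comp (sinkExt s) (sinkExt t) := by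
  ext ⟨x | x, y | y⟩ <;> simp [SetRel.comp, Option.exists]

theorem sinkExt_union (s t : SetRel X X) : sinkExt (s ∪ t) = sinkExt s ∪ sinkExt t := by
  ext ⟨x | x, y | y⟩ <;> simp

theorem sourceExt_injective : Function.Injective (sourceExt (X := X)) := by
  rintro s t h
  ext ⟨x, y⟩
  rw [← mem_sourceExt_some s, ← mem_sourceExt_some t, h]

theorem sourceExt_comp (s t : SetRel X X) :
    sourceExt (s.comp t) = SetRel.comp (sourceExt s) (sourceExt t) := by
  ext ⟨x | x, y | y⟩ <;> simp [SetRel.comp, Option.exists]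

theorem sourceExt_union (s t : SetRel X X) : sourceExt (s ∪ t) = sourceExt s ∪ sourceExt t := by
  ext ⟨x | x, y | y⟩ <;> simp

/-- The pairs `(some x, none)` record the complement of the domain; on the domain the old pairs are
unchanged. -/
theorem chaosExt_injective : Function.Injective (chaosExt (X := X)) := by
  rintro s t h
  have hd : ∀ x, x ∈ s.dom ↔ x ∈ t.dom := fun x => by
    rw [← not_iff_not, ← mem_chaosExt_some_none s, ← mem_chaosExt_some_none t, h]
  have hm : ∀ x y, (x ∈ s.dom → (x, y) ∈ s) ↔ (x ∈ t.dom → (x, y) ∈ t) := fun x y => by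
    rw [← mem_chaosExt_some s, ← mem_chaosExt_some t, h]
  ext ⟨x, y⟩
  exact ⟨fun hs => (hm x y).1 (fun _ => hs) ((hd x).1 ⟨y, hs⟩),
    fun ht => (hm x y).2 (fun _ => ht) ((hd x).2 ⟨y, ht⟩)⟩

/-- If some `s`-successor of `x` lies outside the domain of `t`, that successor is related to
everything, so one bad branch makes the whole angelic composite chaotic at `x`, just as it makes the
demonic one undefined there. -/
theorem chaosExt_demonicComp (s t : SetRel X X) :
    chaosExt (demonicComp s t) = SetRel.comp (chaosExt s) (chaosExt t) := by
  ext ⟨x | x, y⟩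
  · exact iff_of_true (mem_chaosExt_none _ y)
      ⟨none, mem_chaosExt_none _ none, mem_chaosExt_none _ y⟩
  by_cases h : x ∈ s.dom ∧ ∀ w, (x, w) ∈ s → w ∈ t.dom
  · obtain ⟨hx, ht⟩ := h
    have hd : x ∈ (demonicComp s t).dom := by
      obtain ⟨w, hw⟩ := hx
      obtain ⟨v, hv⟩ := ht w hw
      exact ⟨v, ⟨w, hw, hv⟩, ht⟩
    rw [mem_chaosExt_of_mem_dom hd]
    constructor
    · rintro ⟨v, rfl, ⟨w, hw, hv⟩, _⟩
      exact ⟨some w, (mem_chaosExt_some s x w).2 fun _ => hw,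
        (mem_chaosExt_some t w v).2 fun _ => hv⟩
    · rintro ⟨w, hw, hv⟩
      obtain ⟨w', rfl, hw'⟩ := (mem_chaosExt_of_mem_dom hx w).1 hw
      obtain ⟨v, rfl, hv'⟩ := (mem_chaosExt_of_mem_dom (ht w' hw') y).1 hv
      exact ⟨v, rfl, ⟨w', hw', hv'⟩, ht⟩
  · refine iff_of_true (mem_chaosExt_of_not_mem_dom ?_ y) ?_
    · rintro ⟨v, ⟨w, hw, hv⟩, ht⟩
      exact h ⟨⟨w, hw⟩, ht⟩
    · by_cases hx : x ∈ s.dom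
      · have ht : ∃ w, (x, w) ∈ s ∧ w ∉ t.dom := by
          by_contra! hc
          exact h ⟨hx, hc⟩
        obtain ⟨w, hw, hwt⟩ := ht
        exact ⟨some w, (mem_chaosExt_some s x w).2 fun _ => hw,
          mem_chaosExt_of_not_mem_dom hwt y⟩
      · exact ⟨none, mem_chaosExt_of_not_mem_dom hx none, mem_chaosExt_none t y⟩

theorem chaosExt_demonicJoin (s t : SetRel X X) :
    chaosExt (demonicJoin s t) = chaosExt s ∪ chaosExt t := by
  ext ⟨x | x, y | y⟩ <;> simp [demonicJoin, SetRel.dom] <;> grind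

/-- Adding a sink embeds algebras of relations into algebras of left total relations. -/
def sinkEmbedding (X : Type u) : AngelicRel X ↪[compJoin] AngelicRel (Option X) :=
  embeddingOf (N := AngelicRel (Option X)) (sinkExt (X := X)) sinkExt_injective sinkExt_comp
    sinkExt_union

/-- Adding a source embeds algebras of relations into algebras of relations onto the base. -/
def sourceEmbedding (X : Type u) : AngelicRel X ↪[compJoin] AngelicRel (Option X) :=
  embeddingOf (N := AngelicRel (Option X)) (sourceExt (X := X)) sourceExt_injective
    sourceExt_comp sourceExt_union

/-- Demonic algebras of relations embed into angelic ones. -/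
def chaosEmbedding (X : Type u) : DemonicRel X ↪[compJoin] AngelicRel (Option X) :=
  embeddingOf (N := AngelicRel (Option X)) (chaosExt (X := X)) chaosExt_injective
    chaosExt_demonicComp chaosExt_demonicJoin

theorem demonicComp_of_isLeftTotal {s t : SetRel X X} (ht : IsLeftTotal t) :
    demonicComp s t = SetRel.comp s t := by
  ext ⟨x, y⟩
  exact ⟨fun h => h.1, fun h => ⟨h, fun w _ => ht w⟩⟩

theorem demonicJoin_of_isLeftTotal {s t : SetRel X X} (hs : IsLeftTotal s) (ht : IsLeftTotal t) :
    demonicJoin s t = s ∪ t := by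
  ext ⟨x, y⟩
  exact ⟨fun h => h.1, fun h => ⟨h, hs x, ht x⟩⟩

theorem classR_subset_classL₀ : classR.{u} ⊆ classL₀ := by
  intro A hA
  obtain ⟨X, hX, hne, ⟨g⟩⟩ := mem_classR.1 hA
  refine mem_classL₀.2 ⟨X, hX, hne, (sinkEmbedding X).comp g, fun a => ⟨fun x => ?_, fun y => ?_⟩⟩
  · exact ⟨none, mem_sinkExt_none (X := X) (g a) x⟩
  · cases y with
    | none => exact iff_of_true (mem_sinkExt_none (X := X) (g a) none) rfl
    | some y => exact iff_of_false (not_mem_sinkExt (X := X) (g a) y) (by simp)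

theorem classL₀_subset_classL : classL₀.{u} ⊆ classL := by
  intro A hA
  obtain ⟨X, hX, hne, g, hg⟩ := mem_classL₀.1 hA
  exact mem_classL.2 ⟨Option X, inferInstance, hne, g, fun a => (hg a).1⟩

theorem classL_subset_classT : classL.{u} ⊆ classT := by
  intro A hA
  obtain ⟨X, hX, hne, g, hg⟩ := mem_classL.1 hA
  refine mem_classT.2 ⟨Option X, inferInstance, hne, (sourceEmbedding X).comp g,
    fun a => ⟨fun x => ?_, fun y => ?_⟩⟩
  · cases x with
    | none => exact ⟨none, mem_sourceExt_none (X := X) (g a) none⟩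
    | some x =>
      obtain ⟨y, hy⟩ := hg a x
      exact ⟨some y, (mem_sourceExt_some (X := X) (g a) x y).2 hy⟩
  · exact ⟨none, mem_sourceExt_none (X := X) (g a) y⟩

theorem classT_subset_classR : classT.{u} ⊆ classR := by
  intro A hA
  obtain ⟨X, hX, hne, g, _⟩ := mem_classT.1 hA
  exact mem_classR.2 ⟨X, hX, hne, ⟨g⟩⟩

/-- Left totality makes the side conditions in both demonic operations vacuous. -/
theorem classL_subset_classRDemonic : classL.{u} ⊆ classRDemonic := by
  intro A hA
  obtain ⟨X, hX, hne, g, hg⟩ := mem_classL.1 hA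
  refine mem_classRDemonic.2 ⟨X, hX, hne, ⟨embeddingOf (N := DemonicRel X) g g.injective
    (fun a b => ?_) fun a b => ?_⟩⟩
  · exact (map_opComp g a b).trans (demonicComp_of_isLeftTotal (hg b)).symm
  · exact (map_opJoin g a b).trans (demonicJoin_of_isLeftTotal (hg a) (hg b)).symm

theorem classRDemonic_subset_classR : classRDemonic.{u} ⊆ classR := by
  intro A hA
  obtain ⟨X, hX, hne, ⟨g⟩⟩ := mem_classRDemonic.1 hA
  exact mem_classR.2 ⟨Option X, inferInstance, hne, ⟨(chaosEmbedding X).comp g⟩⟩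

theorem classL_eq_classR : classL.{u} = classR :=
  (classL_subset_classT.trans classT_subset_classR).antisymm
    (classR_subset_classL₀.trans classL₀_subset_classL)

theorem classL₀_eq_classR : classL₀.{u} = classR :=
  (classL₀_subset_classL.trans classL_eq_classR.subset).antisymm classR_subset_classL₀

theorem classT_eq_classR : classT.{u} = classR :=
  classT_subset_classR.antisymm (classL_eq_classR.symm.subset.trans classL_subset_classT)

theorem classRDemonic_eq_classR : classRDemonic.{u} = classR :=
  classRDemonic_subset_classR.antisymm
    (classL_eq_classR.symm.subset.trans classL_subset_classRDemonic)

end Classes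

/-! ### The algebra of a graph with a distinguished point -/

section Closed

variable {P : Type u} {a : P} {E : P → P → Prop}

/-- A set is closed if it contains the distinguished point `a` as soon as it contains an edge. -/
def IsEdgeClosed (a : P) (E : P → P → Prop) (U : Set P) : Prop :=
  ∀ u ∈ U, ∀ v ∈ U, E u v → a ∈ U

/-- The least closed set that contains `U`. -/
def edgeClosure (a : P) (E : P → P → Prop) (U : Set P) : Set P :=
  U ∪ {p | p = a ∧ ∃ u ∈ U, ∃ v ∈ U, E u v}

theorem subset_edgeClosure (U : Set P) : U ⊆ edgeClosure a E U := Set.subset_union_left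

theorem isEdgeClosed_edgeClosure (U : Set P) : IsEdgeClosed a E (edgeClosure a E U) := by
  rintro u (hu | hu) v (hv | hv) h
  · exact Or.inr ⟨rfl, u, hu, v, hv, h⟩
  · exact Or.inr ⟨rfl, hv.2⟩
  · exact Or.inr ⟨rfl, hu.2⟩
  · exact Or.inr ⟨rfl, hu.2⟩

theorem edgeClosure_subset_iff {U J : Set P} (hJ : IsEdgeClosed a E J) :
    edgeClosure a E U ⊆ J ↔ U ⊆ J := by
  refine ⟨(subset_edgeClosure U).trans, fun h => Set.union_subset h ?_⟩
  rintro p ⟨rfl, u, hu, v, hv, he⟩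
  exact hJ u (h hu) v (h hv) he

/-- Two sets are linked if they have different elements, or share the distinguished point. -/
def Linked (a : P) (U W : Set P) : Prop := ∃ u ∈ U, ∃ w ∈ W, u ≠ w ∨ u = a

/-- The carrier of the algebra of a graph `E` with a distinguished point `a`: closed sets, paired
with a truth value. -/
def ClosedAlg (a : P) (E : P → P → Prop) : Type u := {U : Set P // IsEdgeClosed a E U} × Prop

/-- The product of `(U, i)` and `(W, j)` is the empty set, paired with whether `U` and `W` are
linked; the join is the closure of the union, paired with the disjunction. -/
instance closedAlgStructure (a : P) (E : P → P → Prop) : compJoin.Structure (ClosedAlg a E) where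
  funMap := fun {_} f => match f with
    | .comp => fun v => (⟨∅, fun _ h => h.elim⟩, Linked a (v 0).1.1 (v 1).1.1)
    | .join => fun v => (⟨edgeClosure a E ((v 0).1.1 ∪ (v 1).1.1), isEdgeClosed_edgeClosure _⟩,
        (v 0).2 ∨ (v 1).2)
  RelMap := fun {_} r => Empty.elim r

instance : Nonempty (ClosedAlg a E) := ⟨⟨∅, fun _ h => h.elim⟩, True⟩

theorem ClosedAlg.ext {s t : ClosedAlg a E} (h₁ : s.1.1 = t.1.1) (h₂ : s.2 ↔ t.2) : s = t :=
  Prod.ext (Subtype.ext h₁) (propext h₂)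

@[simp] theorem opComp_fst (s t : ClosedAlg a E) : (opComp s t).1.1 = ∅ := rfl

@[simp] theorem opJoin_fst (s t : ClosedAlg a E) :
    (opJoin s t).1.1 = edgeClosure a E (s.1.1 ∪ t.1.1) := rfl

/-! ### Representability of the graph algebra and 2-colourability of the graph. -/

/-- Points of the representation: a source, a target, and a point between them for every two closed
sets that together contain all points of the graph but possibly `a`. -/
inductive RepPoint (a : P) (E : P → P → Prop) : Type u
  | source : RepPoint a E
  | target : RepPoint a E
  | middle (J K : Set P) (hJ : IsEdgeClosed a E J) (hK : IsEdgeClosed a E K)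
      (hJK : ∀ p, p ≠ a → p ∈ J ∨ p ∈ K) : RepPoint a E

/-- The relation represented by an element of the algebra. -/
def repRel (s : ClosedAlg a E) : SetRel (RepPoint a E) (RepPoint a E) :=
  {p | match p.1, p.2 with
    | .source, .target => s.2
    | .source, .middle J _ _ _ _ => ¬ s.1.1 ⊆ J
    | .middle _ K _ _ _, .target => ¬ s.1.1 ⊆ K
    | _, _ => False}

theorem repRel_injective : Function.Injective (repRel : ClosedAlg a E → _) := by
  have key : ∀ s t : ClosedAlg a E, repRel s = repRel t → s.1.1 ⊆ t.1.1 := by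
    intro s t h
    by_contra hc
    -- With `K` the whole set the covering condition is free, so `J` may be any closed set, in
    -- particular that of `t`.
    have hm : (RepPoint.source, RepPoint.middle t.1.1 Set.univ t.1.2 (fun _ _ _ _ _ => trivial)
        (fun _ _ => Or.inr trivial)) ∈ repRel s := hc
    rw [h] at hm
    exact hm subset_rfl
  intro s t h
  have h2 : (RepPoint.source, RepPoint.target) ∈ repRel s ↔
    (RepPoint.source, RepPoint.target) ∈ repRel t := by rw [h]
  exact ClosedAlg.ext ((key s t h).antisymm (key t s h.symm)) h2

/-- Middle points test inclusion in closed sets only, and such tests do not see the difference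
between a union and its closure. -/
theorem repRel_opJoin (s t : ClosedAlg a E) : repRel (opJoin s t) = repRel s ∪ repRel t := by
  ext ⟨p, q⟩
  have key : ∀ J, IsEdgeClosed a E J →
      (¬ (opJoin s t).1.1 ⊆ J ↔ ¬ s.1.1 ⊆ J ∨ ¬ t.1.1 ⊆ J) := fun J hJ => by
    rw [opJoin_fst, edgeClosure_subset_iff hJ, Set.union_subset_iff, not_and_or]
  cases p with
  | source =>
    cases q with
    | source => exact ⟨fun h => h.elim, fun h => h.elim id id⟩
    | target => exact Iff.rfl
    | middle J K hJ hK hJK => exact key J hJ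
  | target => cases q <;> exact ⟨fun h => h.elim, fun h => h.elim id id⟩
  | middle J K hJ hK hJK =>
    cases q with
    | source => exact ⟨fun h => h.elim, fun h => h.elim id id⟩
    | target => exact key K hK
    | middle => exact ⟨fun h => h.elim, fun h => h.elim id id⟩

/-- If the points other than `a` have a proper colouring by `c` and its complement, then linked
sets can be told apart by a middle point. -/
theorem exists_middle_of_linked (hE : ∀ p, p ≠ a → ¬ E p p) (c : P → Prop)
    (hc : ∀ u v, u ≠ a → v ≠ a → E u v → (c u ↔ ¬ c v)) {U W : Set P} (h : Linked a U W) :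
    ∃ J K, IsEdgeClosed a E J ∧ IsEdgeClosed a E K ∧ (∀ p, p ≠ a → p ∈ J ∨ p ∈ K) ∧
      ¬ U ⊆ J ∧ ¬ W ⊆ K := by
  have hcompl : ∀ v, v ≠ a → IsEdgeClosed a E {v}ᶜ := fun v hv _ _ _ _ _ => Ne.symm hv
  have hsing : ∀ v, v ≠ a → IsEdgeClosed a E {v} := by
    rintro v hv _ rfl _ rfl h
    exact (hE _ hv h).elim
  obtain ⟨u, hu, w, hw, huw⟩ := h
  by_cases hua : u = a
  · by_cases hwa : w = a
    -- The only case that needs the colouring: two closed sets missing `a` contain no edge, and they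
    -- must cover all other points.
    · refine ⟨{p | p ≠ a ∧ c p}, {p | p ≠ a ∧ ¬ c p}, ?_, ?_, fun p hp => ?_, ?_, ?_⟩
      · rintro u ⟨hu, hcu⟩ v ⟨hv, hcv⟩ h
        exact absurd hcv ((hc u v hu hv h).1 hcu)
      · rintro u ⟨hu, hcu⟩ v ⟨hv, hcv⟩ h
        exact absurd ((hc u v hu hv h).2 hcv) hcu
      · exact (em (c p)).imp (⟨hp, ·⟩) (⟨hp, ·⟩)
      · exact fun h => (h hu).1 hua
      · exact fun h => (h hw).1 hwa
    · exact ⟨{w}, {w}ᶜ, hsing w hwa, hcompl w hwa, fun p _ => em (p = w),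
        fun h => hwa ((h hu).symm.trans hua), fun h => h hw rfl⟩
  · by_cases hwa : w = a
    · exact ⟨{u}ᶜ, {u}, hcompl u hua, hsing u hua, fun p _ => (em (p = u)).symm,
        fun h => h hu rfl, fun h => hua ((h hw).symm.trans hwa)⟩
    · refine ⟨{u}ᶜ, {w}ᶜ, hcompl u hua, hcompl w hwa, fun p _ => ?_,
        fun h => h hu rfl, fun h => h hw rfl⟩
      by_contra! hp
      simp only [Set.mem_compl_iff, Set.mem_singleton_iff, not_not] at hp
      exact huw.elim (fun h => h (hp.1.symm.trans hp.2)) hua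

/-- The only paths of length two run from source through a middle point to target. Since `J` and `K`
cover all points but `a`, elements missed by `J` and by `K` can coincide only at `a`, which is
linkedness. -/
theorem repRel_opComp (hE : ∀ p, p ≠ a → ¬ E p p) (c : P → Prop)
    (hc : ∀ u v, u ≠ a → v ≠ a → E u v → (c u ↔ ¬ c v)) (s t : ClosedAlg a E) :
    repRel (opComp s t) = SetRel.comp (repRel s) (repRel t) := by
  have hemp : ∀ J : Set P, ¬ (opComp s t).1.1 ⊆ J ↔ False := fun J => by simp
  have hnone : ∀ p q : RepPoint a E, (p ≠ .source ∨ q ≠ .target) →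
      ((p, q) ∈ repRel (opComp s t) ↔ False) ∧
      ((p, q) ∈ SetRel.comp (repRel s) (repRel t) ↔ False) := by
    intro p q h
    constructor
    · cases p <;> cases q <;> simp_all [repRel]
    · refine iff_of_false ?_ id
      rintro ⟨z, hz, hz'⟩
      cases p <;> cases q <;> cases z <;> simp_all [repRel]
  ext ⟨p, q⟩
  by_cases h : p ≠ .source ∨ q ≠ .target
  · exact (hnone p q h).1.trans (hnone p q h).2.symm
  · push Not at h
    obtain ⟨rfl, rfl⟩ := h
    constructor
    · intro h
      obtain ⟨J, K, hJ, hK, hJK, hU, hW⟩ := exists_middle_of_linked hE c hc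
        (show Linked a s.1.1 t.1.1 from h)
      exact ⟨.middle J K hJ hK hJK, hU, hW⟩
    · rintro ⟨z, hz, hz'⟩
      cases z with
      | source => exact hz.elim
      | target => exact hz'.elim
      | middle J K hJ hK hJK =>
        obtain ⟨u, hu, huJ⟩ := Set.not_subset.1 hz
        obtain ⟨w, hw, hwK⟩ := Set.not_subset.1 hz'
        refine ⟨u, hu, w, hw, ?_⟩
        by_contra! hc
        obtain ⟨rfl, hua⟩ := hc
        exact (hJK u hua).elim huJ hwK

/-- The algebra of a bipartite graph is representable. -/
theorem exists_embedding_of_colouring (hE : ∀ p, p ≠ a → ¬ E p p) (c : P → Prop)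
    (hc : ∀ u v, u ≠ a → v ≠ a → E u v → (c u ↔ ¬ c v)) :
    Nonempty (ClosedAlg a E ↪[compJoin] AngelicRel (RepPoint a E)) :=
  ⟨embeddingOf (N := AngelicRel (RepPoint a E)) repRel repRel_injective
    (repRel_opComp hE c hc) repRel_opJoin⟩

/-- Conversely, a representation of the algebra of a graph yields a proper colouring. -/
theorem exists_colouring_of_embedding {X : Type u} (hE : ∀ p, p ≠ a → ¬ E p p)
    (g : ClosedAlg a E ↪[compJoin] AngelicRel X) :
    ∃ c : P → Prop, ∀ u v, u ≠ a → v ≠ a → E u v → (c u ↔ ¬ c v) := by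
  let r : ClosedAlg a E → SetRel X X := g
  have hj : ∀ s t, r (opJoin s t) = r s ∪ r t := map_opJoin g
  have hm : ∀ s t, r (opComp s t) = SetRel.comp (r s) (r t) := map_opComp g
  let pt : {p : P // p = a ∨ ¬ E p p} → ClosedAlg a E := fun p =>
    (⟨{p.1}, by rintro _ rfl _ rfl h; exact p.2.elim Eq.symm (absurd h)⟩, False)
  let bot : ClosedAlg a E := (⟨∅, fun _ h => h.elim⟩, False)
  let α : ClosedAlg a E := pt ⟨a, Or.inl rfl⟩
  let π : ∀ p, p ≠ a → ClosedAlg a E := fun p hp => pt ⟨p, Or.inr (hE p hp)⟩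
  -- As `a` is linked to itself, the square of `α` lies strictly above `bot`. A pair in the
  -- difference factors through a point `z`, which defines the colouring.
  have hle : r bot ⊆ r (opComp α α) := by
    have : opJoin bot (opComp α α) = opComp α α := by
      refine ClosedAlg.ext ?_ (iff_of_eq (false_or _))
      change edgeClosure a E (∅ ∪ ∅) = ∅
      simp [edgeClosure]
    rw [← this, hj]
    exact Set.subset_union_left
  have hne : r bot ≠ r (opComp α α) := fun h => by
    have h2 := congrArg Prod.snd (g.injective h)
    have : Linked a ({a} : Set P) {a} := ⟨a, rfl, a, rfl, Or.inr rfl⟩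
    exact (iff_of_eq h2).2 this
  obtain ⟨⟨x, y⟩, hxy, hbot⟩ := Set.exists_of_ssubset (hle.ssubset_of_ne hne)
  rw [hm] at hxy
  obtain ⟨z, hxz, hzy⟩ := hxy
  have hedge : ∀ u v (hu : u ≠ a) (hv : v ≠ a), E u v → r α ⊆ r (π u hu) ∪ r (π v hv) := by
    intro u v hu hv he
    have : opJoin α (opJoin (π u hu) (π v hv)) = opJoin (π u hu) (π v hv) := by
      refine ClosedAlg.ext ?_ (iff_of_eq (false_or _))
      have ha : a ∈ edgeClosure a E ({u} ∪ {v}) :=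
        Or.inr ⟨rfl, u, Or.inl rfl, v, Or.inr rfl, he⟩
      have hcl := isEdgeClosed_edgeClosure (a := a) (E := E) ({u} ∪ {v})
      refine Set.Subset.antisymm ((edgeClosure_subset_iff hcl).2
        (Set.union_subset (Set.singleton_subset_iff.2 ha) subset_rfl)) ?_
      exact Set.subset_union_right.trans (subset_edgeClosure _)
    rw [← hj, ← this, hj]
    exact Set.subset_union_left
  have hdisj : ∀ p (hp : p ≠ a), (x, z) ∈ r (π p hp) → (z, y) ∈ r (π p hp) → False := by
    intro p hp h1 h2
    have : opComp (π p hp) (π p hp) = bot := by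
      refine ClosedAlg.ext rfl (iff_of_false ?_ id)
      rintro ⟨_, rfl, _, rfl, h | h⟩
      · exact h rfl
      · exact hp h
    apply hbot
    rw [← this, hm]
    exact ⟨z, h1, h2⟩
  -- Along an edge, `(x, z)` and `(z, y)` each belong to one of the two endpoints, and no endpoint
  -- has both; hence exactly one endpoint has `(x, z)`.
  refine ⟨fun p => ∃ hp : p ≠ a, (x, z) ∈ r (π p hp), fun u v hu hv he => ?_⟩
  have h1 := hedge u v hu hv he hxz
  have h2 := hedge u v hu hv he hzy
  have h3 := hdisj u hu
  have h4 := hdisj v hv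
  simp only [Set.mem_union] at h1 h2
  simp only [hu, hv, ne_eq, not_false_eq_true, exists_true_left]
  tauto

end Closed

/-! ### Ultraproducts of graph algebras -/

section Ultraproduct

open Filter

variable {P : Type u} {a : P} {E : ℕ → P → P → Prop} {𝒰 : Ultrafilter ℕ}

/-- The germs of sequences lying eventually in the given sets. -/
def germSet (𝒰 : Ultrafilter ℕ) (U : ℕ → Set P) : Set (Germ (𝒰 : Filter ℕ) P) :=
  {x | ∃ f : ℕ → P, (f : Germ (𝒰 : Filter ℕ) P) = x ∧ ∀ᶠ n in 𝒰, f n ∈ U n}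

theorem coe_mem_germSet {U : ℕ → Set P} {f : ℕ → P} :
    (f : Germ (𝒰 : Filter ℕ) P) ∈ germSet 𝒰 U ↔ ∀ᶠ n in 𝒰, f n ∈ U n := by
  refine ⟨?_, fun h => ⟨f, rfl, h⟩⟩
  rintro ⟨g, hg, h⟩
  filter_upwards [Germ.coe_eq.1 hg, h] with n h₁ h₂
  rwa [← h₁]

/-- The ultraproduct of graphs on a common set of points. -/
def germGraph (𝒰 : Ultrafilter ℕ) (E : ℕ → P → P → Prop) (x y : Germ (𝒰 : Filter ℕ) P) : Prop :=
  ∃ f g : ℕ → P, (f : Germ (𝒰 : Filter ℕ) P) = x ∧ (g : Germ (𝒰 : Filter ℕ) P) = y ∧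
    ∀ᶠ n in 𝒰, E n (f n) (g n)

theorem germGraph_coe {f g : ℕ → P} :
    germGraph 𝒰 E f g ↔ ∀ᶠ n in 𝒰, E n (f n) (g n) := by
  refine ⟨?_, fun h => ⟨f, g, rfl, rfl, h⟩⟩
  rintro ⟨f', g', hf, hg, h⟩
  filter_upwards [Germ.coe_eq.1 hf, Germ.coe_eq.1 hg, h] with n h₁ h₂ h₃
  rwa [← h₁, ← h₂]

theorem isEdgeClosed_germSet {U : ℕ → Set P} (h : ∀ n, IsEdgeClosed a (E n) (U n)) :
    IsEdgeClosed ((fun _ => a : ℕ → P) : Germ (𝒰 : Filter ℕ) P) (germGraph 𝒰 E)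
      (germSet 𝒰 U) := by
  rintro _ ⟨f, rfl, hf⟩ _ ⟨g, rfl, hg⟩ he
  rw [coe_mem_germSet]
  filter_upwards [hf, hg, germGraph_coe.1 he] with n h₁ h₂ h₃
  exact h n _ h₁ _ h₂ h₃

theorem germSet_congr {U W : ℕ → Set P} (h : ∀ᶠ n in 𝒰, U n = W n) :
    germSet 𝒰 U = germSet 𝒰 W := by
  ext x
  induction x using Germ.inductionOn with
  | h f =>
    rw [coe_mem_germSet, coe_mem_germSet]
    exact eventually_congr (h.mono fun n hn => by rw [hn])

/-- Otherwise choosing points of `U n` outside `W n` would give a germ in one set and not in the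
other. -/
theorem eventually_subset_of_germSet_subset {U W : ℕ → Set P} (h : germSet 𝒰 U ⊆ germSet 𝒰 W) :
    ∀ᶠ n in 𝒰, U n ⊆ W n := by
  by_contra hc
  rw [← Ultrafilter.eventually_not] at hc
  have hc' : ∀ᶠ n in 𝒰, ∃ p, p ∈ U n ∧ p ∉ W n := hc.mono fun n hn => Set.not_subset.1 hn
  have : Nonempty P := ⟨hc'.exists.choose_spec.choose⟩
  obtain ⟨f, hf⟩ := skolem.1 hc'
  have hU := coe_mem_germSet.2 (hf.mono fun n hn => hn.1)
  obtain ⟨n, hn, hn'⟩ := ((coe_mem_germSet.1 (h hU)).and hf).exists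
  exact hn'.2 hn

theorem germSet_empty : germSet 𝒰 (fun _ => (∅ : Set P)) = ∅ := by
  ext x
  refine iff_of_false ?_ id
  rintro ⟨f, -, hf⟩
  obtain ⟨n, hn⟩ := hf.exists
  exact hn

theorem germSet_union (U W : ℕ → Set P) :
    germSet 𝒰 (fun n => U n ∪ W n) = germSet 𝒰 U ∪ germSet 𝒰 W := by
  ext x
  induction x using Germ.inductionOn with
  | h f =>
    rw [Set.mem_union, coe_mem_germSet, coe_mem_germSet, coe_mem_germSet]
    exact Ultrafilter.eventually_or

/-- An ultrafilter decides which half of the closure a sequence lies in; in the second half, the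
endpoints of the edges can be chosen along the sequence. -/
theorem germSet_edgeClosure (U : ℕ → Set P) :
    germSet 𝒰 (fun n => edgeClosure a (E n) (U n)) =
      edgeClosure ((fun _ => a : ℕ → P) : Germ (𝒰 : Filter ℕ) P) (germGraph 𝒰 E)
        (germSet 𝒰 U) := by
  have : Nonempty P := ⟨a⟩
  apply Set.Subset.antisymm
  · rintro _ ⟨f, rfl, hf⟩
    rcases Ultrafilter.eventually_or.1 hf with h | h
    · exact Or.inl (coe_mem_germSet.2 h)
    · obtain ⟨v, hv⟩ := skolem.1 (h.mono fun n hn => hn.2)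
      obtain ⟨w, hw⟩ := skolem.1 (hv.mono fun n hn => hn.2)
      exact Or.inr ⟨Germ.coe_eq.2 (h.mono fun n hn => hn.1),
        v, coe_mem_germSet.2 (hv.mono fun n hn => hn.1),
        w, coe_mem_germSet.2 (hw.mono fun n hn => hn.1),
        germGraph_coe.2 (hw.mono fun n hn => hn.2)⟩
  · refine (edgeClosure_subset_iff
      (isEdgeClosed_germSet fun n => isEdgeClosed_edgeClosure (U n))).2 ?_
    rintro _ ⟨f, rfl, hf⟩
    exact coe_mem_germSet.2 (hf.mono fun n hn => subset_edgeClosure _ hn)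

theorem linked_germSet (U W : ℕ → Set P) :
    Linked ((fun _ => a : ℕ → P) : Germ (𝒰 : Filter ℕ) P) (germSet 𝒰 U) (germSet 𝒰 W) ↔
      ∀ᶠ n in 𝒰, Linked a (U n) (W n) := by
  constructor
  · rintro ⟨_, ⟨f, rfl, hf⟩, _, ⟨g, rfl, hg⟩, h⟩
    have h' : ∀ᶠ n in 𝒰, f n ≠ g n ∨ f n = a := by
      refine Ultrafilter.eventually_or.2 (h.imp (fun h => ?_) fun h => Germ.coe_eq.1 h)
      exact Ultrafilter.eventually_not.2 fun hc => h (Germ.coe_eq.2 hc)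
    filter_upwards [hf, hg, h'] with n h₁ h₂ h₃
    exact ⟨f n, h₁, g n, h₂, h₃⟩
  · intro h
    have : Nonempty P := ⟨a⟩
    obtain ⟨f, hf⟩ := skolem.1 h
    obtain ⟨g, hg⟩ := skolem.1 (hf.mono fun n hn => hn.2)
    refine ⟨f, coe_mem_germSet.2 (hf.mono fun n hn => hn.1),
      g, coe_mem_germSet.2 (hg.mono fun n hn => hn.1), ?_⟩
    refine (Ultrafilter.eventually_or.1 (hg.mono fun n hn => hn.2)).imp (fun h => ?_)
      fun h => Germ.coe_eq.2 h
    intro hc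
    exact Ultrafilter.eventually_not.1 h (Germ.coe_eq.1 hc)

theorem opComp_ultraproduct {M : ℕ → Type u} [∀ n, compJoin.Structure (M n)] (s t : ∀ n, M n) :
    opComp (s : (𝒰 : Filter ℕ).Product M) (t : (𝒰 : Filter ℕ).Product M) =
      ((fun n => opComp (s n) (t n) : ∀ n, M n) : (𝒰 : Filter ℕ).Product M) := by
  let c : compJoin.Functions 2 := CompJoinFunc.comp
  refine Eq.trans (congrArg (Structure.funMap c) ?_) ((Ultraproduct.funMap_cast (u := 𝒰)
    c ![s, t]).trans (congrArg _ (funext fun n => congrArg (Structure.funMap c) ?_)))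
  all_goals funext i; fin_cases i <;> rfl

theorem opJoin_ultraproduct {M : ℕ → Type u} [∀ n, compJoin.Structure (M n)] (s t : ∀ n, M n) :
    opJoin (s : (𝒰 : Filter ℕ).Product M) (t : (𝒰 : Filter ℕ).Product M) =
      ((fun n => opJoin (s n) (t n) : ∀ n, M n) : (𝒰 : Filter ℕ).Product M) := by
  let c : compJoin.Functions 2 := CompJoinFunc.join
  refine Eq.trans (congrArg (Structure.funMap c) ?_) ((Ultraproduct.funMap_cast (u := 𝒰)
    c ![s, t]).trans (congrArg _ (funext fun n => congrArg (Structure.funMap c) ?_)))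
  all_goals funext i; fin_cases i <;> rfl

/-- The map from the ultraproduct of the algebras to the algebra of the ultraproduct. -/
def ultraMap (𝒰 : Ultrafilter ℕ) (a : P) (E : ℕ → P → P → Prop) :
    (𝒰 : Filter ℕ).Product (fun n => ClosedAlg a (E n)) →
      ClosedAlg ((fun _ => a : ℕ → P) : Germ (𝒰 : Filter ℕ) P) (germGraph 𝒰 E) :=
  Quotient.lift (fun s => (⟨germSet 𝒰 fun n => (s n).1.1, isEdgeClosed_germSet fun n => (s n).1.2⟩,
      ∀ᶠ n in 𝒰, (s n).2)) fun s t h => by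
    have h' : ∀ᶠ n in 𝒰, s n = t n := h
    refine ClosedAlg.ext (germSet_congr (h'.mono fun n hn => by rw [hn]))
      (eventually_congr (h'.mono fun n hn => by rw [hn]))

theorem ultraMap_injective : Function.Injective (ultraMap 𝒰 a E) := by
  intro x y
  refine Quotient.inductionOn₂ x y fun s t h => Quotient.sound ?_
  have h₁ : germSet 𝒰 (fun n => (s n).1.1) = germSet 𝒰 (fun n => (t n).1.1) :=
    congrArg (fun s => s.1.1) h
  have h₂ : (∀ᶠ n in 𝒰, (s n).2) ↔ ∀ᶠ n in 𝒰, (t n).2 := iff_of_eq (congrArg Prod.snd h)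
  have h₃ : ∀ᶠ n in 𝒰, ((s n).2 ↔ (t n).2) := by
    by_cases hs : ∀ᶠ n in 𝒰, (s n).2
    · filter_upwards [hs, h₂.1 hs] with n h h' using iff_of_true h h'
    · have ht := mt h₂.2 hs
      rw [← Ultrafilter.eventually_not] at hs ht
      filter_upwards [hs, ht] with n h h' using iff_of_false h h'
  change ∀ᶠ n in 𝒰, s n = t n
  filter_upwards [eventually_subset_of_germSet_subset h₁.subset,
    eventually_subset_of_germSet_subset h₁.symm.subset, h₃] with n hst hts h
  exact ClosedAlg.ext (hst.antisymm hts) h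

/-- The ultraproduct of the algebras of graphs embeds into the algebra of the ultraproduct. -/
def ultraEmbedding (𝒰 : Ultrafilter ℕ) (a : P) (E : ℕ → P → P → Prop) :
    (𝒰 : Filter ℕ).Product (fun n => ClosedAlg a (E n)) ↪[compJoin]
      ClosedAlg ((fun _ => a : ℕ → P) : Germ (𝒰 : Filter ℕ) P) (germGraph 𝒰 E) :=
  embeddingOf (ultraMap 𝒰 a E) ultraMap_injective
    (fun x y => Quotient.inductionOn₂ x y fun s t => by
      refine (congrArg (ultraMap 𝒰 a E) (opComp_ultraproduct s t)).trans ?_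
      exact ClosedAlg.ext germSet_empty (linked_germSet _ _).symm)
    (fun x y => Quotient.inductionOn₂ x y fun s t => by
      refine (congrArg (ultraMap 𝒰 a E) (opJoin_ultraproduct s t)).trans ?_
      refine ClosedAlg.ext ((germSet_edgeClosure _).trans ?_) Ultrafilter.eventually_or
      exact congrArg _ (germSet_union _ _))

end Ultraproduct

/-! ### Long odd cycles -/

section OddCycle

open Filter

/-- The infinite path on the natural numbers, with an additional edge that closes an odd cycle of
length `2 * n + 3` through the positive numbers up to `2 * n + 3`. -/
def chordPath (n : ℕ) (x y : ULift.{u} ℕ) : Prop :=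
  y.down = x.down + 1 ∨ x.down = 2 * n + 3 ∧ y.down = 1

theorem not_chordPath_self (n : ℕ) (x : ULift.{u} ℕ) : ¬ chordPath n x x := by
  unfold chordPath
  omega

/-- The algebra of an odd cycle. -/
abbrev chordAlg (n : ℕ) : Type u := ClosedAlg (ULift.up.{u} 0) (chordPath n)

/-- Colours alternate along the path, so `1` and `2 * n + 3` agree, against the chord that joins
them. The cycle avoids the distinguished point `0`. -/
theorem chordAlg_not_mem_classR (n : ℕ) :
    Bundled.of (c := compJoin.Structure) (chordAlg.{u} n) ∉ classR := by
  intro h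
  obtain ⟨X, _, _, ⟨g⟩⟩ := mem_classR.1 h
  obtain ⟨c, hc⟩ := exists_colouring_of_embedding (fun p _ => not_chordPath_self n p) g
  have hne : ∀ k : ℕ, ULift.up.{u} (k + 1) ≠ ULift.up 0 := fun k h => by
    simpa using congrArg ULift.down h
  have hodd : ∀ k : ℕ, c ⟨2 * k + 1⟩ ↔ c ⟨1⟩ := by
    intro k
    induction k with
    | zero => exact Iff.rfl
    | succ k ih =>
      have h₁ := hc ⟨2 * k + 1⟩ ⟨2 * k + 1 + 1⟩ (hne _) (hne _) (Or.inl rfl)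
      have h₂ := hc ⟨2 * k + 1 + 1⟩ ⟨2 * (k + 1) + 1⟩ (hne _) (hne _) (Or.inl rfl)
      tauto
  have h₁ := hc ⟨2 * (n + 1) + 1⟩ ⟨1⟩ (hne _) (hne 0) (Or.inr ⟨by ring, rfl⟩)
  have h₂ := hodd (n + 1)
  tauto

/-- The ultraproduct of the odd cycles has no odd cycle: colour a germ by its parity, and exchange
the colours on the germs of constants. -/
theorem exists_colouring_germGraph_chordPath {𝒰 : Ultrafilter ℕ} (h𝒰 : (𝒰 : Filter ℕ) ≤ atTop) :
    ∃ c : Germ (𝒰 : Filter ℕ) (ULift.{u} ℕ) → Prop,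
      ∀ x y, germGraph 𝒰 chordPath x y → (c x ↔ ¬ c y) := by
  let ev : Set (Germ (𝒰 : Filter ℕ) (ULift.{u} ℕ)) := germSet 𝒰 fun _ => {p | Even p.down}
  let st : Germ (𝒰 : Filter ℕ) (ULift.{u} ℕ) → Prop := fun x =>
    ∃ k : ℕ, x ∈ germSet 𝒰 fun _ => {ULift.up k}
  refine ⟨fun x => (x ∈ ev ↔ st x), ?_⟩
  rintro _ _ ⟨f, g, rfl, rfl, h⟩
  have hst : ∀ f : ℕ → ULift.{u} ℕ, st f ↔ ∃ k, ∀ᶠ n in 𝒰, (f n).down = k := fun f =>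
    exists_congr fun k => coe_mem_germSet.trans (eventually_congr (Eventually.of_forall fun n =>
      ⟨fun h => congrArg ULift.down h, fun h => ULift.down_injective h⟩))
  have hev : ∀ f : ℕ → ULift.{u} ℕ, ↑f ∈ ev ↔ ∀ᶠ n in 𝒰, Even (f n).down := fun f =>
    coe_mem_germSet
  simp only [hst, hev]
  rcases Ultrafilter.eventually_or.1 h with h | h
  · have h₁ : (∀ᶠ n in 𝒰, Even (g n).down) ↔ ¬ ∀ᶠ n in 𝒰, Even (f n).down := by
      rw [← Ultrafilter.eventually_not]
      exact eventually_congr (h.mono fun n hn => by rw [hn, Nat.even_add_one])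
    have h₂ : (∃ k, ∀ᶠ n in 𝒰, (f n).down = k) ↔ ∃ k, ∀ᶠ n in 𝒰, (g n).down = k := by
      constructor
      · rintro ⟨k, hk⟩
        exact ⟨k + 1, by filter_upwards [h, hk] with n h₁ h₂ using by rw [h₁, h₂]⟩
      · rintro ⟨k, hk⟩
        exact ⟨k - 1, by filter_upwards [h, hk] with n h₁ h₂ using by omega⟩
    tauto
  · have h₁ : ¬ ∀ᶠ n in 𝒰, Even (f n).down := by
      rw [← Ultrafilter.eventually_not]
      exact h.mono fun n hn => by rw [hn.1, Nat.not_even_iff_odd]; exact ⟨n + 1, by ring⟩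
    have h₂ : ¬ ∀ᶠ n in 𝒰, Even (g n).down := by
      rw [← Ultrafilter.eventually_not]
      exact h.mono fun n hn => by rw [hn.2]; decide
    -- The chord starts at the germ of `2 * n + 3`, beyond every constant, and ends at the constant
    -- `1`. Both germs are odd, so exchanging colours on constants separates them; successor steps
    -- never cross between the two kinds.
    have h₃ : ¬ ∃ k, ∀ᶠ n in 𝒰, (f n).down = k := by
      rintro ⟨k, hk⟩
      obtain ⟨n, ⟨hn, hn'⟩, hk'⟩ := ((h.and hk).and (h𝒰 (eventually_ge_atTop k))).exists
      have := hn.1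
      change k ≤ n at hk'
      omega
    have h₄ : ∃ k, ∀ᶠ n in 𝒰, (g n).down = k := ⟨1, h.mono fun n hn => hn.2⟩
    tauto

theorem ultraproduct_chordAlg_mem_classR {𝒰 : Ultrafilter ℕ} (h𝒰 : (𝒰 : Filter ℕ) ≤ atTop) :
    Bundled.of (c := compJoin.Structure) ((𝒰 : Filter ℕ).Product chordAlg.{u}) ∈ classR := by
  obtain ⟨c, hc⟩ := exists_colouring_germGraph_chordPath.{u} h𝒰
  have hE : ∀ p, ¬ germGraph 𝒰 chordPath.{u} p p := by
    rintro p hp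
    have := hc p p hp
    tauto
  obtain ⟨g⟩ := exists_embedding_of_colouring
    (a := ((fun _ => ULift.up 0 : ℕ → ULift.{u} ℕ) : Germ (𝒰 : Filter ℕ) (ULift.{u} ℕ)))
    (fun p _ => hE p) c (fun x y _ _ => hc x y)
  exact mem_classR.2 ⟨_, ⟨RepPoint.source⟩, Ultraproduct.Product.instNonempty,
    ⟨g.comp (ultraEmbedding 𝒰 (ULift.up 0) chordPath)⟩⟩

/-- By Łoś, each axiom holds in almost all factors; finitely many axioms then hold together in a
single factor, which lies outside the class. -/
theorem not_finitelyAxiomatisable_classR : ¬ FinitelyAxiomatisable classR.{u} := by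
  rintro ⟨T, hT, h⟩
  have hU := ((h _).1 (ultraproduct_chordAlg_mem_classR.{u} (𝒰 := hyperfilter ℕ)
    Nat.hyperfilter_le_atTop)).2
  have hall : ∀ᶠ n in (hyperfilter ℕ : Filter ℕ), ∀ φ ∈ T, chordAlg.{u} n ⊨ φ :=
    hT.eventually_all.2 fun φ hφ => Ultraproduct.sentence_realize φ |>.1
      (hU.realize_of_mem φ hφ)
  obtain ⟨n, hn⟩ := hall.exists
  exact chordAlg_not_mem_classR n ((h _).2 ⟨inferInstanceAs (Nonempty (chordAlg n)), ⟨hn⟩⟩)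

end OddCycle

end DemonicRelations

theorem mainTheorem4 :
    (DemonicRelations.classR.{u} = DemonicRelations.classL.{u} ∧
      DemonicRelations.classL.{u} = DemonicRelations.classL₀.{u} ∧
      DemonicRelations.classL₀.{u} = DemonicRelations.classT.{u} ∧
      DemonicRelations.classT.{u} = DemonicRelations.classRDemonic.{u}) ∧
    (∀ φ : DemonicRelations.compJoin.Sentence,
      (∀ A ∈ DemonicRelations.classR.{u}, FirstOrder.Language.Sentence.Realize A φ) ↔
        ∀ A ∈ DemonicRelations.classRDemonic.{u}, FirstOrder.Language.Sentence.Realize A φ) ∧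
    ¬ DemonicRelations.FinitelyAxiomatisable DemonicRelations.classR.{u} ∧
    ¬ DemonicRelations.FinitelyAxiomatisable DemonicRelations.classL.{u} ∧
    ¬ DemonicRelations.FinitelyAxiomatisable DemonicRelations.classL₀.{u} ∧
    ¬ DemonicRelations.FinitelyAxiomatisable DemonicRelations.classT.{u} ∧
    ¬ DemonicRelations.FinitelyAxiomatisable DemonicRelations.classRDemonic.{u} := by
  rw [DemonicRelations.classL_eq_classR, DemonicRelations.classL₀_eq_classR,
    DemonicRelations.classT_eq_classR, DemonicRelations.classRDemonic_eq_classR]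
  have h := DemonicRelations.not_finitelyAxiomatisable_classR.{u}
  exact ⟨⟨rfl, rfl, rfl, rfl⟩, fun _ => Iff.rfl, h, h, h, h, h⟩
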